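/- Let $M$ be a connected matroid on a finite ground set $E$ with rank function $r$, where a connected matroid is one with non-empty ground set that is not a direct sum of two matroids with non-empty ground sets. Let $\mathcal I(M)$ and $\mathcal B(M)$ be its families of independent sets and of bases, let $M^*$ be the dual matroid, with rank function $r^*$, and let $A\subseteq E$, $A^c=E\setminus A$. Write $(A,a)_==\{I\subseteq E:|I\cap A|=a\}$, and define $(A,a)_\le$, $(A,a)_<$, $(A,a)_>$ analogously. For $\mathcal S=\mathcal I(M)$ or $\mathcal S=\mathcal B(M)$, a face of $\mathcal S$ is a family $\mathcal S\cap\bigcap_i (A_i,r(A_i))_=$ with $A_i\subseteq E$; a facet is an inclusion-maximal face among the faces different from $\mathcal S$; and $(A,r(A))_\le$ is facet-defining for $\mathcal S$ if $\mathcal S\cap(A,r(A))_=$ is a facet of $\mathcal S$. Facet-defining inequalities for $\mathcal I(M^*)$ are defined in the same way, using $r^*$. Call $(A,r(A))_\le$ non-trivial if both $(E,r(E))_=\cap(A,r(A))_>$ and $(E,r(E))_=\cap(A,r(A))_<$ are non-empty. Consider the following conditions. (a) $(A,r(A))_\le$ is facet-defining for $\mathcal B(M)$. (b) $\mathcal B(M)\cap(A,r(A))_=$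 is the family of bases of a matroid on $E$ whose connected components are exactly the two sets $A$ and $A^c$. (c) The restriction $M|A$ and the contraction $M/A$ are both connected. (d) $(A,r(A))_\le$ is facet-defining for $\mathcal I(M)$, and $(A^c,r^*(A^c))_\le$ is facet-defining for $\mathcal I(M^*)$. Then (a), (b) and (c) are equivalent. If $(A,r(A))_\le$ is non-trivial, then all four conditions (a), (b), (c), (d) are equivalent. If $(A,r(A))_\le$ is not non-trivial, then (d) fails. -/

import Mathlib

open Set

namespace MatroidFacet

/-- The independence system `I(M)`: the family of independent sets of `M`. -/
def indepSystem {α : Type*} (M : Matroid α) : Set (Set α) := {I | M.Indep I}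

/-- The base system `B(M)`: the family of bases of `M`. -/
def baseSystem {α : Type*} (M : Matroid α) : Set (Set α) := {B | M.IsBase B}

/-- `(A, a)_=`: the subsets of the ground set `E` meeting `A` in exactly `a` elements. -/
def levelEq {α : Type*} (E A : Set α) (a : ℕ∞) : Set (Set α) :=
  {I | I ⊆ E ∧ (I ∩ A).encard = a}

/-- `(A, a)_>`: the subsets of the ground set `E` meeting `A` in more than `a` elements. -/
def levelGT {α : Type*} (E A : Set α) (a : ℕ∞) : Set (Set α) :=
  {I | I ⊆ E ∧ a < (I ∩ A).encard}

/-- `(A, a)_<`: the subsets of the ground set `E` meeting `A` in fewer than `a` elements. -/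
def levelLT {α : Type*} (E A : Set α) (a : ℕ∞) : Set (Set α) :=
  {I | I ⊆ E ∧ (I ∩ A).encard < a}

/-- `S ∩ (A, r(A))_=`, where `r` is the rank function of `M`; it is used with `S = I(M)` and with
`S = B(M)`. -/
def faceOf {α : Type*} (M : Matroid α) (S : Set (Set α)) (A : Set α) : Set (Set α) :=
  S ∩ levelEq M.E A (M.eRk A)

/-- `F` is a face of `S` (with `S = I(M)` or `S = B(M)`): `F = S ∩ ⋂ᵢ (Aᵢ, r(Aᵢ))_=` for some
family of subsets `Aᵢ` of the ground set. -/
def IsFace {α : Type*} (M : Matroid α) (S F : Set (Set α)) : Prop :=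
  ∃ 𝒜 : Set (Set α), (∀ A ∈ 𝒜, A ⊆ M.E) ∧ F = S ∩ ⋂ A ∈ 𝒜, levelEq M.E A (M.eRk A)

/-- A facet of `S` is an inclusion-maximal face among the proper faces. -/
def IsFacet {α : Type*} (M : Matroid α) (S F : Set (Set α)) : Prop :=
  Maximal (fun G => IsFace M S G ∧ G ≠ S) F

/-- `(A, r(A))_≤` is a facet-defining inequality of the independence system `I(M)`. -/
def IndepFacetDefining {α : Type*} (M : Matroid α) (A : Set α) : Prop :=
  IsFacet M (indepSystem M) (faceOf M (indepSystem M) A)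

/-- `(A, r(A))_≤` is a facet-defining inequality of the base system `B(M)`. -/
def BaseFacetDefining {α : Type*} (M : Matroid α) (A : Set α) : Prop :=
  IsFacet M (baseSystem M) (faceOf M (baseSystem M) A)

/-- `(A, r(A))_≤` is non-trivial: both `(E, r(E))_= ∩ (A, r(A))_>` and
`(E, r(E))_= ∩ (A, r(A))_<` are non-empty. -/
def NonTrivialIneq {α : Type*} (M : Matroid α) (A : Set α) : Prop :=
  (levelEq M.E M.E (M.eRk M.E) ∩ levelGT M.E A (M.eRk A)).Nonempty ∧
    (levelEq M.E M.E (M.eRk M.E) ∩ levelLT M.E A (M.eRk A)).Nonempty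

/-- `X` is a separator of `M`: `M` is the direct sum of a matroid on `X` and a matroid on the
complement of `X` in the ground set. -/
def IsSeparator {α : Type*} (M : Matroid α) (X : Set α) : Prop :=
  ∃ (M₁ M₂ : Matroid α) (h : Disjoint M₁.E M₂.E), M₁.E = X ∧ M = M₁.disjointSum M₂ h

/-- `M` is connected: its ground set is non-empty, and `M` is not a direct sum of two matroids
with non-empty ground sets. -/
def IsConnected {α : Type*} (M : Matroid α) : Prop :=
  M.E.Nonempty ∧
    ¬ ∃ (M₁ M₂ : Matroid α) (h : Disjoint M₁.E M₂.E),
      M₁.E.Nonempty ∧ M₂.E.Nonempty ∧ M = M₁.disjointSum M₂ h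

/-- The connected components of `M`: the minimal non-empty separators. -/
def components {α : Type*} (M : Matroid α) : Set (Set α) :=
  {C | Minimal (fun X => X.Nonempty ∧ IsSeparator M X) C}

/-- The set family `F` is the base system of a matroid on `E`, and the set of connected components
of that matroid is `𝒞`. (A matroid is determined by its ground set and its bases.) -/
def IsBaseSystemWithComponents {α : Type*} (E : Set α) (F 𝒞 : Set (Set α)) : Prop :=
  ∃ N : Matroid α, N.E = E ∧ baseSystem N = F ∧ components N = 𝒞

end MatroidFacet

/-!
A set `X` is a separator of `M` if and only if every base of `M` meets `X` in a basis of `X`. The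
face of `B(M)` induced by `A` consists of the bases of `M|A ⊕ M/A`, so the faces containing it are
governed by the separators of that direct sum; conversely, if nested sets `X ⊆ Y` induce the same
face, then `Y \ X` is a separator of `M`, hence trivial when `M` is connected. Thus the face of `A`
is maximal exactly when `A` and its complement are the only proper separators of `M|A ⊕ M/A`, that
is, when both summands are connected.

The facets of `I(M)` come from the flats `A`, not all of whose elements are loops, with `M|A`
connected. When `M/A` is connected, `A` is a flat unless it spans `M`; applying this to `M` and to
`M*` turns (d) into (c) together with non-triviality, which says that `A` is neither spanning nor
independent, does not consist of loops, and its complement does not consist of coloops.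
-/

namespace MatroidFacet

open scoped Matroid

section Separators

variable {α : Type*} {M N : Matroid α} {A B I J K X Y : Set α}

theorem isSeparator_iff_indep :
    IsSeparator M X ↔ X ⊆ M.E ∧ ∀ I ⊆ M.E, M.Indep (I ∩ X) → M.Indep (I \ X) → M.Indep I := by
  constructor
  · rintro ⟨M₁, M₂, hdisj, rfl, rfl⟩
    refine ⟨Matroid.disjointSum_ground_eq ▸ subset_union_left, fun I hI h₁ h₂ => ?_⟩
    have hI₂ : I \ M₁.E ∩ M₂.E = I ∩ M₂.E := by
      rw [sdiff_inter_right_comm, hdisj.symm.mono_left inter_subset_right |>.sdiff_eq_left]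
    rw [Matroid.disjointSum_indep_iff] at h₁ h₂ ⊢
    rw [inter_assoc, inter_self] at h₁
    rw [hI₂] at h₂
    exact ⟨h₁.1, h₂.2.1, Matroid.disjointSum_ground_eq ▸ hI⟩
  · rintro ⟨hX, h⟩
    have hdisj : Disjoint (M ↾ X).E (M ↾ (M.E \ X)).E := disjoint_sdiff_right
    refine ⟨M ↾ X, M ↾ (M.E \ X), hdisj, rfl, Matroid.ext_indep ?_ fun I hI => ?_⟩
    · rw [Matroid.disjointSum_ground_eq]
      exact (union_sdiff_cancel hX).symm
    simp only [Matroid.disjointSum_indep_iff, Matroid.restrict_indep_iff, inter_subset_right,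
      and_true, Matroid.restrict_ground_eq, union_sdiff_cancel hX, hI, ← inter_sdiff_assoc,
      inter_eq_self_of_subset_left hI]
    exact ⟨fun hind => ⟨hind.inter_right X, hind.sdiff X, sdiff_subset_sdiff_left hI⟩,
      fun hind => h I hI hind.1 hind.2.1⟩

theorem IsSeparator.subset_ground (h : IsSeparator M X) : X ⊆ M.E :=
  (isSeparator_iff_indep.1 h).1

theorem IsSeparator.compl (h : IsSeparator M X) : IsSeparator M (M.E \ X) := by
  obtain ⟨M₁, M₂, hdisj, rfl, rfl⟩ := h
  refine ⟨M₂, M₁, hdisj.symm, ?_, Matroid.disjointSum_comm⟩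
  rw [Matroid.disjointSum_ground_eq, union_sdiff_left, hdisj.symm.sdiff_eq_left]

theorem IsSeparator.inter (hX : IsSeparator M X) (hY : IsSeparator M Y) :
    IsSeparator M (X ∩ Y) := by
  rw [isSeparator_iff_indep] at hX hY ⊢
  refine ⟨inter_subset_left.trans hX.1, fun I hI h₁ h₂ => hX.2 I hI ?_ ?_⟩
  · refine hY.2 _ (inter_subset_left.trans hI) (by rwa [inter_assoc]) (h₂.subset ?_)
    exact fun e he => ⟨he.1.1, fun h => he.2 h.2⟩
  · exact h₂.subset (sdiff_subset_sdiff_right inter_subset_left)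

theorem IsSeparator.sdiff (hX : IsSeparator M X) (hY : IsSeparator M Y) :
    IsSeparator M (X \ Y) := by
  have := hX.inter hY.compl
  rwa [← inter_sdiff_assoc, inter_eq_self_of_subset_left hX.subset_ground] at this

theorem isConnected_iff_isSeparator :
    IsConnected M ↔ M.E.Nonempty ∧ ∀ X, IsSeparator M X → X = ∅ ∨ X = M.E := by
  refine and_congr_right fun _ => ⟨?_, ?_⟩
  · rintro h X ⟨M₁, M₂, hdisj, rfl, hM⟩
    by_contra! hne
    refine h ⟨M₁, M₂, hdisj, hne.1, ?_, hM⟩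
    refine nonempty_iff_ne_empty.2 fun h₂ => hne.2 ?_
    rw [hM, Matroid.disjointSum_ground_eq, h₂, union_empty]
  · rintro h ⟨M₁, M₂, hdisj, h₁, h₂, hM⟩
    rcases h M₁.E ⟨M₁, M₂, hdisj, rfl, hM⟩ with h0 | hE
    · exact h₁.ne_empty h0
    · rw [hM, Matroid.disjointSum_ground_eq] at hE
      exact h₂.ne_empty (hdisj.symm.eq_bot_of_le (subset_union_right.trans hE.symm.subset))

theorem indep_union_iff_of_isBasis (hI : M.IsBasis I X) (hJ : M.IsBasis J X)
    (hK : Disjoint X K) : M.Indep (K ∪ I) ↔ M.Indep (K ∪ J) := by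
  rw [← hI.contract_indep_iff_of_disjoint hK, hJ.contract_indep_iff_of_disjoint hK]

theorem isSeparator_of_indep_union (hJ : M.IsBasis J X) (hK : M.IsBasis K (M.E \ X))
    (hJK : M.Indep (J ∪ K)) : IsSeparator M X := by
  refine isSeparator_iff_indep.2 ⟨hJ.subset_ground, fun I hI h₁ h₂ => ?_⟩
  obtain ⟨J', hJ', hIJ'⟩ := h₁.subset_isBasis_of_subset inter_subset_right hJ.subset_ground
  obtain ⟨K', hK', hIK'⟩ := h₂.subset_isBasis_of_subset (sdiff_subset_sdiff_left hI)
  have hJK' : M.Indep (J ∪ K') :=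
    (indep_union_iff_of_isBasis hK hK' (disjoint_sdiff_left.mono_right hJ.subset)).1 hJK
  rw [union_comm,
    indep_union_iff_of_isBasis hJ hJ' (disjoint_sdiff_right.mono_right hK'.subset)] at hJK'
  refine hJK'.subset ?_
  rw [← inter_union_sdiff I X, union_comm]
  exact union_subset_union hIK' hIJ'

theorem IsSeparator.indep_union (h : IsSeparator M X) (hJ : M.Indep J) (hJX : J ⊆ X)
    (hK : M.Indep K) (hKX : Disjoint K X) : M.Indep (J ∪ K) := by
  refine (isSeparator_iff_indep.1 h).2 _ (union_subset hJ.subset_ground hK.subset_ground) ?_ ?_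
  · rwa [union_inter_distrib_right, inter_eq_self_of_subset_left hJX, hKX.inter_eq, union_empty]
  · rwa [union_sdiff_distrib, sdiff_eq_empty.2 hJX, hKX.sdiff_eq_left, empty_union]

theorem IsSeparator.isBasis_inter (h : IsSeparator M X) (hB : M.IsBase B) :
    M.IsBasis (B ∩ X) X := by
  obtain ⟨J, hJ, hBJ⟩ := (hB.indep.inter_right X).subset_isBasis_of_subset inter_subset_right
    h.subset_ground
  have hind := h.indep_union hJ.indep hJ.subset (hB.indep.sdiff X) disjoint_sdiff_left
  have hBeq : B = J ∪ B \ X := hB.eq_of_subset_indep hind <|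
    (inter_union_sdiff B X).symm.subset.trans (union_subset_union_left _ hBJ)
  have hJB : J ⊆ B ∩ X := subset_inter (subset_union_left.trans hBeq.symm.subset) hJ.subset
  rwa [hBJ.antisymm hJB]

theorem isSeparator_of_isBasis_inter (hB : M.IsBase B) (h : M.IsBasis (B ∩ X) X)
    (hc : M.IsBasis (B ∩ (M.E \ X)) (M.E \ X)) : IsSeparator M X :=
  isSeparator_of_indep_union h hc <|
    hB.indep.subset (union_subset inter_subset_left inter_subset_left)

theorem isSeparator_iff_forall_isBasis_inter :
    IsSeparator M X ↔ ∀ B, M.IsBase B → M.IsBasis (B ∩ X) X := by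
  refine ⟨fun h B => h.isBasis_inter, fun h => ?_⟩
  obtain ⟨K, hK⟩ := M.exists_isBasis (M.E \ X)
  obtain ⟨B, hB, rfl⟩ := hK.exists_isBase
  exact isSeparator_of_isBasis_inter hB (h B hB) hK

theorem isSeparator_empty (M : Matroid α) : IsSeparator M ∅ :=
  isSeparator_iff_forall_isBasis_inter.2 fun B _ => by
    rw [inter_empty]; exact M.empty_indep.isBasis_self

theorem IsConnected.isSeparator_iff (hM : IsConnected M) :
    IsSeparator M X ↔ X = ∅ ∨ X = M.E := by
  refine ⟨(isConnected_iff_isSeparator.1 hM).2 X, ?_⟩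
  rintro (rfl | rfl)
  · exact isSeparator_empty M
  · simpa only [sdiff_empty] using (isSeparator_empty M).compl

theorem IsSeparator.dual (h : IsSeparator M X) : IsSeparator M✶ X := by
  obtain ⟨B, hB⟩ := M.exists_isBase
  refine isSeparator_of_isBasis_inter hB.compl_isBase_dual ?_
    (hB.compl_inter_isBasis_of_inter_isBasis (h.isBasis_inter hB))
  have := hB.compl_inter_isBasis_of_inter_isBasis (h.compl.isBasis_inter hB)
  rwa [sdiff_sdiff_cancel_left h.subset_ground] at this

theorem IsConnected.dual (hM : IsConnected M) : IsConnected M✶ := by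
  rw [isConnected_iff_isSeparator] at hM ⊢
  exact ⟨hM.1, fun X hX => hM.2 X (by simpa only [Matroid.dual_dual] using hX.dual)⟩

theorem isConnected_dual_iff : IsConnected M✶ ↔ IsConnected M :=
  ⟨fun h => by simpa only [Matroid.dual_dual] using h.dual, IsConnected.dual⟩

theorem isConnected_dual_restrict_compl :
    IsConnected (M✶ ↾ (M.E \ A)) ↔ IsConnected (M ／ A) := by
  rw [← isConnected_dual_iff (M := M ／ A), Matroid.dual_contract]; rfl

theorem isConnected_dual_contract_compl (hA : A ⊆ M.E) :
    IsConnected (M✶ ／ (M.E \ A)) ↔ IsConnected (M ↾ A) := by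
  rw [← isConnected_dual_iff, ← Matroid.dual_delete, Matroid.dual_dual, Matroid.delete,
    sdiff_sdiff_cancel_left hA]

theorem isSeparator_loops (M : Matroid α) : IsSeparator M M.loops := by
  refine isSeparator_iff_forall_isBasis_inter.2 fun B hB => ?_
  exact Matroid.isBasis_loops_iff.2 hB.indep.disjoint_loops.inter_eq

theorem IsConnected.loops_eq_empty_or_ground (hM : IsConnected M) :
    M.loops = ∅ ∨ M.loops = M.E :=
  (isConnected_iff_isSeparator.1 hM).2 _ (isSeparator_loops M)

theorem IsConnected.loops_eq_empty (hM : IsConnected M) (hA : A ⊆ M.E) (h : ¬ A ⊆ M.loops) :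
    M.loops = ∅ :=
  hM.loops_eq_empty_or_ground.resolve_right fun hE => h (hE ▸ hA)

theorem isSeparator_disjointSum_iff {h : Disjoint M.E N.E} (hX : X ⊆ M.E) :
    IsSeparator (M.disjointSum N h) X ↔ IsSeparator M X := by
  simp only [isSeparator_iff_indep, Matroid.disjointSum_indep_iff, Matroid.disjointSum_ground_eq]
  constructor
  · rintro ⟨-, hsep⟩
    refine ⟨hX, fun I hI h₁ h₂ => ?_⟩
    have hN : ∀ Y ⊆ I, Y ∩ N.E = ∅ := fun Y hY => (h.mono_left (hY.trans hI)).inter_eq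
    have := hsep I (hI.trans subset_union_left)
    simp only [hN _ inter_subset_left, hN _ sdiff_subset, hN I Subset.rfl,
      inter_eq_self_of_subset_left hI, inter_eq_self_of_subset_left (inter_subset_left.trans hI),
      inter_eq_self_of_subset_left (sdiff_subset.trans hI), N.empty_indep, true_and] at this
    exact (this ⟨h₁, (inter_subset_left.trans hI).trans subset_union_left⟩
      ⟨h₂, (sdiff_subset.trans hI).trans subset_union_left⟩).1
  · rintro ⟨-, hsep⟩
    refine ⟨hX.trans subset_union_left, fun I hI h₁ h₂ => ⟨hsep _ inter_subset_right ?_ ?_, ?_, hI⟩⟩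
    · exact h₁.1.subset fun e he => ⟨⟨he.1.1, he.2⟩, he.1.2⟩
    · exact h₂.1.subset fun e he => ⟨⟨he.1.1, he.2⟩, he.1.2⟩
    · exact h₂.2.1.subset fun e he => ⟨⟨he.1, fun heX => h.notMem_of_mem_left (hX heX) he.2⟩, he.2⟩

theorem eq_or_eq_of_isSeparator_disjointSum {h : Disjoint M.E N.E} (hM : IsConnected M)
    (hN : IsConnected N) (hX : IsSeparator (M.disjointSum N h) X) :
    X = ∅ ∨ X = M.E ∨ X = N.E ∨ X = M.E ∪ N.E := by
  have hXM : X ∩ M.E = ∅ ∨ X ∩ M.E = M.E := hM.isSeparator_iff.1 <|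
    (isSeparator_disjointSum_iff inter_subset_right).1 (hX.inter ⟨M, N, h, rfl, rfl⟩)
  have hXN : X ∩ N.E = ∅ ∨ X ∩ N.E = N.E := hN.isSeparator_iff.1 <|
    (isSeparator_disjointSum_iff (h := h.symm) inter_subset_right).1 <|
      Matroid.disjointSum_comm (h := h) ▸ hX.inter ⟨N, M, h.symm, rfl, Matroid.disjointSum_comm⟩
  have hXE : X ∩ M.E ∪ X ∩ N.E = X := by
    rw [← inter_union_distrib_left, inter_eq_left, ← Matroid.disjointSum_ground_eq (h := h)]
    exact hX.subset_ground
  rcases hXM with hXM | hXM <;> rcases hXN with hXN | hXN <;> rw [hXM, hXN] at hXE <;>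
    simp [← hXE]

theorem mem_components_iff {C : Set α} :
    C ∈ components M ↔ Minimal (fun X => X.Nonempty ∧ IsSeparator M X) C := Iff.rfl

theorem isSeparator_of_mem_components {C : Set α} (hC : C ∈ components M) : IsSeparator M C :=
  (mem_components_iff.1 hC).prop.2

theorem nonempty_of_mem_components {C : Set α} (hC : C ∈ components M) : C.Nonempty :=
  (mem_components_iff.1 hC).prop.1

theorem disjoint_or_subset_of_mem_components {C : Set α} (hC : C ∈ components M)
    (hX : IsSeparator M X) : Disjoint C X ∨ C ⊆ X := by
  rw [disjoint_iff_inter_eq_empty]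
  refine (C ∩ X).eq_empty_or_nonempty.imp_right fun hne => ?_
  have hCX : IsSeparator M (C ∩ X) := (isSeparator_of_mem_components hC).inter hX
  exact inter_eq_left.1 ((mem_components_iff.1 hC).eq_of_subset ⟨hne, hCX⟩ inter_subset_left)

theorem eq_of_mem_components {C D : Set α} (hC : C ∈ components M) (hD : D ∈ components M)
    (h : ¬ Disjoint C D) : C = D :=
  ((disjoint_or_subset_of_mem_components hC (isSeparator_of_mem_components hD)).resolve_left
    h).antisymm <|
  (disjoint_or_subset_of_mem_components hD (isSeparator_of_mem_components hC)).resolve_left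
    fun h' => h h'.symm

theorem ground_mem_components_disjointSum_iff {h : Disjoint M.E N.E} :
    M.E ∈ components (M.disjointSum N h) ↔ IsConnected M := by
  rw [isConnected_iff_isSeparator]
  constructor
  · refine fun hC => ⟨nonempty_of_mem_components hC, fun X hX => ?_⟩
    exact (disjoint_or_subset_of_mem_components hC
      ((isSeparator_disjointSum_iff hX.subset_ground).2 hX)).imp
      (fun hd => hd.symm.eq_bot_of_le hX.subset_ground) hX.subset_ground.antisymm
  · refine fun ⟨hne, hM⟩ => ⟨⟨hne, M, N, h, rfl, rfl⟩, fun X hX hXM => ?_⟩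
    exact ((hM X ((isSeparator_disjointSum_iff hXM).1 hX.2)).resolve_left hX.1.ne_empty).ge

theorem components_disjointSum_eq_pair_iff {h : Disjoint M.E N.E} :
    components (M.disjointSum N h) = {M.E, N.E} ↔ IsConnected M ∧ IsConnected N := by
  rw [← ground_mem_components_disjointSum_iff (h := h),
    ← ground_mem_components_disjointSum_iff (h := h.symm), Matroid.disjointSum_comm (N := M)]
  refine ⟨fun hc => ⟨hc.ge (Or.inl rfl), hc.ge (Or.inr rfl)⟩,
    fun ⟨hM, hN⟩ => Subset.antisymm (fun C hC => ?_) (pair_subset hM hN)⟩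
  obtain ⟨e, he⟩ := nonempty_of_mem_components hC
  rcases Matroid.disjointSum_ground_eq ▸ (isSeparator_of_mem_components hC).subset_ground he with
    heM | heN
  · exact Or.inl (eq_of_mem_components hC hM (not_disjoint_iff.2 ⟨e, he, heM⟩))
  · exact Or.inr (eq_of_mem_components hC hN (not_disjoint_iff.2 ⟨e, he, heN⟩))

end Separators

section FaceMatroid

variable {α : Type*} {M : Matroid α} {A B I J X Y P Q : Set α}

theorem disjoint_restrict_ground_contract_ground (M : Matroid α) (A : Set α) :
    Disjoint (M ↾ A).E (M ／ A).E := disjoint_sdiff_right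

/-- The matroid `M|A ⊕ M/A`. For `A ⊆ M.E` it has ground set `M.E`, and its bases are the bases
of `M` that meet `A` in a basis of `A`, so it presents the face of `B(M)` induced by `A`. -/
def faceMatroid (M : Matroid α) (A : Set α) : Matroid α :=
  (M ↾ A).disjointSum (M ／ A) (disjoint_restrict_ground_contract_ground M A)

theorem faceMatroid_ground (hA : A ⊆ M.E) : (faceMatroid M A).E = M.E :=
  Matroid.disjointSum_ground_eq.trans (union_sdiff_cancel hA)

theorem faceMatroid_isBasis_iff_of_subset (hA : A ⊆ M.E) (hY : Y ⊆ A) :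
    (faceMatroid M A).IsBasis J Y ↔ M.IsBasis J Y := by
  have hYA : Disjoint Y (M.E \ A) := disjoint_sdiff_right.mono_left hY
  rw [faceMatroid, Matroid.disjointSum_isBasis_iff, Matroid.restrict_ground_eq,
    Matroid.contract_ground, inter_eq_self_of_subset_left hY, union_sdiff_cancel hA, hYA.inter_eq,
    Matroid.isBasis_empty_iff, Matroid.isBasis_restrict_iff hA]
  constructor
  · rintro ⟨⟨hJ, -⟩, -, hJY, -⟩
    rwa [inter_eq_self_of_subset_left (hJY.trans hY)] at hJ
  · refine fun hJ => ⟨?_, (hYA.mono_left hJ.subset).inter_eq, hJ.subset, hY.trans hA⟩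
    rw [inter_eq_self_of_subset_left (hJ.subset.trans hY)]
    exact ⟨hJ, hY⟩

theorem faceMatroid_isBasis_iff_of_superset (hAY : A ⊆ Y) (hY : Y ⊆ M.E) :
    (faceMatroid M A).IsBasis J Y ↔ M.IsBasis J Y ∧ M.IsBasis (J ∩ A) A := by
  have hA : A ⊆ M.E := hAY.trans hY
  have hYA : Y ∩ (M.E \ A) = Y \ A := by
    rw [← inter_sdiff_assoc, inter_eq_self_of_subset_left hY]
  rw [faceMatroid, Matroid.disjointSum_isBasis_iff, Matroid.restrict_ground_eq,
    Matroid.contract_ground, inter_eq_self_of_subset_right hAY, union_sdiff_cancel hA, hYA,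
    Matroid.isBasis_restrict_iff hA, and_iff_left Subset.rfl]
  constructor
  · rintro ⟨hJA, hJc, hJY, -⟩
    have hJE : J ∩ (M.E \ A) = J \ A := by
      rw [← inter_sdiff_assoc, inter_eq_self_of_subset_left (hJY.trans hY)]
    rw [hJE] at hJc
    have hJ : M.Indep J := by
      rw [← sdiff_union_inter J A, ← hJA.contract_indep_iff_of_disjoint disjoint_sdiff_right]
      exact hJc.indep
    have hAJ : A ⊆ M.closure J :=
      hJA.subset_closure.trans (M.closure_subset_closure inter_subset_left)
    have hYJ : Y \ A ⊆ M.closure (J ∪ A) := by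
      have := hJc.subset_closure
      rw [Matroid.contract_closure_eq, sdiff_union_self] at this
      exact this.trans sdiff_subset
    refine ⟨hJ.isBasis_of_subset_of_subset_closure hJY fun e he => ?_, hJA⟩
    by_cases heA : e ∈ A
    · exact hAJ heA
    · exact M.closure_subset_closure_of_subset_closure
        (union_subset (M.subset_closure J (hJY.trans hY)) hAJ) (hYJ ⟨he, heA⟩)
  · rintro ⟨hJ, hJA⟩
    refine ⟨hJA, ?_, hJ.subset, hY⟩
    rw [← inter_sdiff_assoc, inter_eq_self_of_subset_left hJ.indep.subset_ground]
    exact hJ.contract_isBasis hJA (by rw [sdiff_union_inter]; exact hJ.indep)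

theorem faceMatroid_isBase_iff (hA : A ⊆ M.E) :
    (faceMatroid M A).IsBase B ↔ M.IsBase B ∧ M.IsBasis (B ∩ A) A := by
  rw [← Matroid.isBasis_ground_iff, ← Matroid.isBasis_ground_iff, faceMatroid_ground hA,
    faceMatroid_isBasis_iff_of_superset hA Subset.rfl]

theorem indep_of_indep_faceMatroid (hA : A ⊆ M.E) (hI : (faceMatroid M A).Indep I) : M.Indep I := by
  obtain ⟨B, hB, hIB⟩ := hI.exists_isBase_superset
  exact ((faceMatroid_isBase_iff hA).1 hB).1.indep.subset hIB

theorem isSeparator_faceMatroid_self (M : Matroid α) (A : Set α) :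
    IsSeparator (faceMatroid M A) A :=
  ⟨M ↾ A, M ／ A, disjoint_restrict_ground_contract_ground M A, rfl, rfl⟩

theorem isSeparator_faceMatroid_of_forall_isBasis_inter (hA : A ⊆ M.E) (hY : Y ⊆ M.E)
    (h : ∀ B, (faceMatroid M A).IsBase B → M.IsBasis (B ∩ Y) Y) :
    IsSeparator (faceMatroid M A) Y := by
  have hYN : Y ⊆ (faceMatroid M A).E := by rwa [faceMatroid_ground hA]
  refine isSeparator_iff_forall_isBasis_inter.2 fun B hB => ?_
  obtain ⟨J, hJ, hBJ⟩ := (hB.indep.inter_right Y).subset_isBasis_of_subset inter_subset_right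
  have := (h B hB).eq_of_subset_indep (indep_of_indep_faceMatroid hA hJ.indep) hBJ hJ.subset
  rwa [this]

theorem isSeparator_sdiff_of_faceMatroid_eq (hPQ : P ⊆ Q) (hQ : Q ⊆ M.E)
    (h : faceMatroid M P = faceMatroid M Q) : IsSeparator M (Q \ P) := by
  have hP : P ⊆ M.E := hPQ.trans hQ
  have hsep : IsSeparator (faceMatroid M Q) (Q \ P) :=
    (isSeparator_faceMatroid_self M Q).sdiff (h ▸ isSeparator_faceMatroid_self M P)
  obtain ⟨B, hB⟩ := (faceMatroid M Q).exists_isBase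
  have hinter := hsep.isBasis_inter hB
  have hcompl := hsep.compl.isBasis_inter hB
  rw [faceMatroid_isBasis_iff_of_subset hQ sdiff_subset] at hinter
  rw [faceMatroid_ground hQ, ← h, faceMatroid_isBasis_iff_of_superset
    (subset_sdiff.2 ⟨hP, disjoint_sdiff_right⟩) sdiff_subset] at hcompl
  exact isSeparator_of_isBasis_inter ((faceMatroid_isBase_iff hQ).1 hB).1 hinter hcompl.1

end FaceMatroid

section Faces

variable {α : Type*} {M N : Matroid α} {A B I X Y : Set α} {S : Set (Set α)}

theorem isFacet_faceOf_iff (hA : A ⊆ M.E) :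
    IsFacet M S (faceOf M S A) ↔ faceOf M S A ≠ S ∧
      ∀ Y ⊆ M.E, faceOf M S Y ≠ S → faceOf M S A ⊆ faceOf M S Y →
        faceOf M S A = faceOf M S Y := by
  have hface : ∀ Y ⊆ M.E, IsFace M S (faceOf M S Y) := fun Y hY =>
    ⟨{Y}, by simpa using hY, by simp [faceOf]⟩
  refine ⟨fun h => ⟨h.prop.2, fun Y hY hne hle => h.eq_of_subset ⟨hface Y hY, hne⟩ hle⟩,
    fun ⟨hne, hmax⟩ => ⟨⟨hface A hA, hne⟩, ?_⟩⟩
  rintro G ⟨⟨𝒜, h𝒜, rfl⟩, hG⟩ hle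
  obtain ⟨Y, hY, hYS⟩ : ∃ Y ∈ 𝒜, faceOf M S Y ≠ S := by
    by_contra! hcon
    exact hG (inter_eq_left.2 (subset_iInter₂ fun Y hY => inter_eq_left.1 (hcon Y hY)))
  have hsub : S ∩ ⋂ A ∈ 𝒜, levelEq M.E A (M.eRk A) ⊆ faceOf M S Y :=
    inter_subset_inter_right _ (biInter_subset_of_mem hY)
  exact hsub.trans (hmax Y (h𝒜 Y hY) hYS (hle.trans hsub)).ge

theorem baseSystem_inj (hE : M.E = N.E) : baseSystem M = baseSystem N ↔ M = N :=
  ⟨fun h => Matroid.ext_isBase hE fun B _ => iff_of_eq (congrArg (B ∈ ·) h), fun h => h ▸ rfl⟩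

theorem mem_levelEq_eRk_iff [M.RankFinite] (hI : M.Indep I) (hX : X ⊆ M.E) :
    I ∈ levelEq M.E X (M.eRk X) ↔ M.IsBasis (I ∩ X) X := by
  refine ⟨fun h => ?_, fun h => ⟨hI.subset_ground, h.encard_eq_eRk⟩⟩
  exact (hI.inter_right X).isBasis_of_eRk_ge (hI.finite.subset inter_subset_left)
    inter_subset_right (by rw [(hI.inter_right X).eRk_eq_encard, h.2])

theorem mem_faceOf_indepSystem_iff [M.RankFinite] (hX : X ⊆ M.E) :
    I ∈ faceOf M (indepSystem M) X ↔ M.Indep I ∧ M.IsBasis (I ∩ X) X :=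
  and_congr_right fun hI => mem_levelEq_eRk_iff hI hX

theorem mem_faceOf_baseSystem_iff [M.RankFinite] (hX : X ⊆ M.E) :
    B ∈ faceOf M (baseSystem M) X ↔ M.IsBase B ∧ M.IsBasis (B ∩ X) X :=
  and_congr_right fun hB => mem_levelEq_eRk_iff hB.indep hX

theorem faceOf_baseSystem_eq [M.RankFinite] (hA : A ⊆ M.E) :
    faceOf M (baseSystem M) A = baseSystem (faceMatroid M A) := by
  ext B
  exact (mem_faceOf_baseSystem_iff hA).trans (faceMatroid_isBase_iff hA).symm

end Faces

section BaseFacets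

variable {α : Type*} {M : Matroid α} [M.RankFinite] {A X Y : Set α}

theorem isBaseSystemWithComponents_iff (hA : A ⊆ M.E) :
    IsBaseSystemWithComponents M.E (faceOf M (baseSystem M) A) {A, M.E \ A} ↔
      IsConnected (M ↾ A) ∧ IsConnected (M ／ A) := by
  rw [faceOf_baseSystem_eq hA, ← components_disjointSum_eq_pair_iff
    (h := disjoint_restrict_ground_contract_ground M A)]
  constructor
  · rintro ⟨N, hNE, hNB, hNC⟩
    rwa [(baseSystem_inj (hNE.trans (faceMatroid_ground hA).symm)).1 hNB] at hNC
  · exact fun h => ⟨faceMatroid M A, faceMatroid_ground hA, rfl, h⟩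

theorem faceOf_baseSystem_eq_self_iff (hA : A ⊆ M.E) :
    faceOf M (baseSystem M) A = baseSystem M ↔ IsSeparator M A := by
  rw [isSeparator_iff_forall_isBasis_inter]
  exact inter_eq_left.trans
    (forall₂_congr fun B hB => mem_levelEq_eRk_iff (Matroid.IsBase.indep hB) hA)

theorem isSeparator_faceMatroid_of_faceOf_subset (hA : A ⊆ M.E) (hY : Y ⊆ M.E)
    (h : faceOf M (baseSystem M) A ⊆ faceOf M (baseSystem M) Y) :
    IsSeparator (faceMatroid M A) Y := by
  refine isSeparator_faceMatroid_of_forall_isBasis_inter hA hY fun B hB => ?_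
  exact ((mem_faceOf_baseSystem_iff hY).1 (h ((faceOf_baseSystem_eq hA).ge hB))).2

theorem faceOf_subset_of_isSeparator_faceMatroid (hA : A ⊆ M.E) (hY : Y ⊆ M.E)
    (hAY : Y ⊆ A ∨ A ⊆ Y) (h : IsSeparator (faceMatroid M A) Y) :
    faceOf M (baseSystem M) A ⊆ faceOf M (baseSystem M) Y := by
  intro B hB
  rw [faceOf_baseSystem_eq hA] at hB
  refine (mem_faceOf_baseSystem_iff hY).2 ⟨((faceMatroid_isBase_iff hA).1 hB).1, ?_⟩
  have hbasis := h.isBasis_inter hB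
  rcases hAY with hYA | hAY
  · exact (faceMatroid_isBasis_iff_of_subset hA hYA).1 hbasis
  · exact ((faceMatroid_isBasis_iff_of_superset hAY hY).1 hbasis).1

theorem isSeparator_sdiff_of_faceOf_eq (hY : Y ⊆ M.E) (hX : X ⊆ Y)
    (h : faceOf M (baseSystem M) X = faceOf M (baseSystem M) Y) : IsSeparator M (Y \ X) := by
  have hXE := hX.trans hY
  rw [faceOf_baseSystem_eq hXE, faceOf_baseSystem_eq hY, baseSystem_inj
    ((faceMatroid_ground hXE).trans (faceMatroid_ground hY).symm)] at h
  exact isSeparator_sdiff_of_faceMatroid_eq hX hY h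

theorem IsConnected.faceOf_baseSystem_ne_iff (hM : IsConnected M) (hA : A ⊆ M.E) :
    faceOf M (baseSystem M) A ≠ baseSystem M ↔ A.Nonempty ∧ (M.E \ A).Nonempty := by
  rw [ne_eq, faceOf_baseSystem_eq_self_iff hA, hM.isSeparator_iff, not_or, nonempty_iff_ne_empty,
    sdiff_nonempty]
  exact and_congr_right fun _ => not_congr ⟨fun h => h.ge, hA.antisymm⟩

theorem IsConnected.eq_of_faceOf_baseSystem_eq (hM : IsConnected M) (hX : X.Nonempty)
    (hXY : X ⊆ Y) (hY : Y ⊆ M.E) (h : faceOf M (baseSystem M) X = faceOf M (baseSystem M) Y) :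
    X = Y := by
  refine hXY.antisymm (sdiff_eq_empty.1 ?_)
  refine (hM.isSeparator_iff.1 (isSeparator_sdiff_of_faceOf_eq hY hXY h)).resolve_right
    fun hE => ?_
  obtain ⟨e, he⟩ := hX
  exact (hE.ge (hY (hXY he))).2 he

theorem BaseFacetDefining.eq_of_isSeparator (h : BaseFacetDefining M A) (hM : IsConnected M)
    (hA : A ⊆ M.E) (hY : IsSeparator (faceMatroid M A) Y) (hYA : Y ⊆ A ∨ A ⊆ Y)
    (hne : Y.Nonempty) (hcne : (M.E \ Y).Nonempty) : Y = A := by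
  have hYE : Y ⊆ M.E := faceMatroid_ground hA ▸ hY.subset_ground
  obtain ⟨hproper, hmax⟩ := (isFacet_faceOf_iff hA).1 h
  have hface := hmax Y hYE ((hM.faceOf_baseSystem_ne_iff hYE).2 ⟨hne, hcne⟩)
    (faceOf_subset_of_isSeparator_faceMatroid hA hYE hYA hY)
  rcases hYA with hYA | hAY
  · exact hM.eq_of_faceOf_baseSystem_eq hne hYA hA hface.symm
  · have hAne : A.Nonempty := ((hM.faceOf_baseSystem_ne_iff hA).1 hproper).1
    exact (hM.eq_of_faceOf_baseSystem_eq hAne hAY hYE hface).symm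

theorem BaseFacetDefining.isConnected_restrict (h : BaseFacetDefining M A) (hM : IsConnected M)
    (hA : A ⊆ M.E) : IsConnected (M ↾ A) := by
  obtain ⟨hne, hcne⟩ := (hM.faceOf_baseSystem_ne_iff hA).1 ((isFacet_faceOf_iff hA).1 h).1
  refine isConnected_iff_isSeparator.2 ⟨hne, fun X hX => or_iff_not_imp_left.2 fun hX0 => ?_⟩
  have hXA : X ⊆ A := hX.subset_ground
  exact h.eq_of_isSeparator hM hA ((isSeparator_disjointSum_iff hX.subset_ground).2 hX)
    (Or.inl hXA) (nonempty_iff_ne_empty.2 hX0) (hcne.mono (sdiff_subset_sdiff_right hXA))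

theorem BaseFacetDefining.isConnected_contract (h : BaseFacetDefining M A) (hM : IsConnected M)
    (hA : A ⊆ M.E) : IsConnected (M ／ A) := by
  obtain ⟨hne, hcne⟩ := (hM.faceOf_baseSystem_ne_iff hA).1 ((isFacet_faceOf_iff hA).1 h).1
  refine isConnected_iff_isSeparator.2 ⟨hcne, fun X hX => or_iff_not_imp_left.2 fun hX0 => ?_⟩
  have hXA : X ⊆ M.E \ A := hX.subset_ground
  have hXc : IsSeparator (faceMatroid M A) (M.E \ X) := by
    rw [← faceMatroid_ground hA, faceMatroid, Matroid.disjointSum_comm]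
    exact ((isSeparator_disjointSum_iff hX.subset_ground).2 hX).compl
  have hAX : A ⊆ M.E \ X := subset_sdiff.2 ⟨hA, (subset_sdiff.1 hXA).2.symm⟩
  have hXE : M.E \ (M.E \ X) = X := sdiff_sdiff_cancel_left (hXA.trans sdiff_subset)
  have heq : M.E \ X = A := h.eq_of_isSeparator hM hA hXc (Or.inr hAX) (hne.mono hAX)
    (hXE.symm ▸ nonempty_iff_ne_empty.2 hX0)
  rw [← hXE, heq, Matroid.contract_ground]

theorem IsConnected.baseFacetDefining_of_isConnected (hM : IsConnected M) (hA : A ⊆ M.E)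
    (hr : IsConnected (M ↾ A)) (hc : IsConnected (M ／ A)) : BaseFacetDefining M A := by
  have hproper := (hM.faceOf_baseSystem_ne_iff hA).2 ⟨hr.1, hc.1⟩
  refine (isFacet_faceOf_iff hA).2 ⟨hproper, fun Y hY hYproper hAY => ?_⟩
  obtain ⟨hYne, hYcne⟩ := (hM.faceOf_baseSystem_ne_iff hY).1 hYproper
  rcases eq_or_eq_of_isSeparator_disjointSum hr hc
    (isSeparator_faceMatroid_of_faceOf_subset hA hY hAY) with hY0 | rfl | rfl | hYE
  · exact absurd hY0 hYne.ne_empty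
  · rfl
  · obtain ⟨B, hB⟩ := (faceMatroid M A).exists_isBase
    have hBA : B ∈ faceOf M (baseSystem M) A := (faceOf_baseSystem_eq hA).ge hB
    exact absurd ((faceOf_baseSystem_eq_self_iff hA).2 <| isSeparator_of_isBasis_inter hBA.1
      ((mem_faceOf_baseSystem_iff hA).1 hBA).2 ((mem_faceOf_baseSystem_iff hY).1 (hAY hBA)).2)
      hproper
  · rw [Matroid.restrict_ground_eq, Matroid.contract_ground, union_sdiff_cancel hA] at hYE
    exact absurd hYE.ge (sdiff_nonempty.1 hYcne)

theorem IsConnected.baseFacetDefining_iff (hM : IsConnected M) (hA : A ⊆ M.E) :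
    BaseFacetDefining M A ↔ IsConnected (M ↾ A) ∧ IsConnected (M ／ A) :=
  ⟨fun h => ⟨h.isConnected_restrict hM hA, h.isConnected_contract hM hA⟩,
    fun h => hM.baseFacetDefining_of_isConnected hA h.1 h.2⟩

end BaseFacets

section IndepFacets

variable {α : Type*} {M : Matroid α} {A J X Y : Set α}

theorem isFlat_iff_not_spanning (hA : A ⊆ M.E) (hc : IsConnected (M ／ A)) :
    M.IsFlat A ↔ ¬ M.Spanning A := by
  have hne : (M.E \ A).Nonempty := hc.1
  refine ⟨fun hflat hspan => hne.ne_empty ?_, fun hspan => ?_⟩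
  · rw [← hspan.closure_eq, hflat.closure, sdiff_eq_empty]
  · rw [Matroid.isFlat_iff_closure_eq]
    refine (sdiff_eq_empty.1 ?_).antisymm (M.subset_closure A hA)
    rw [← Matroid.contract_loops_eq]
    refine hc.loops_eq_empty_or_ground.resolve_right fun hE => hspan ?_
    rw [Matroid.contract_loops_eq, Matroid.contract_ground] at hE
    rw [Matroid.spanning_iff_ground_subset_closure hA, ← union_sdiff_cancel hA, ← hE]
    exact union_subset (M.subset_closure A hA) sdiff_subset

variable [M.RankFinite]

theorem faceOf_indepSystem_eq_self_iff (hA : A ⊆ M.E) :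
    faceOf M (indepSystem M) A = indepSystem M ↔ A ⊆ M.loops := by
  rw [← Matroid.closure_empty, ← Matroid.empty_isBasis_iff]
  constructor
  · intro h
    have := ((mem_faceOf_indepSystem_iff hA).1 (h.ge M.empty_indep)).2
    rwa [empty_inter] at this
  · refine fun h => inter_eq_left.2 fun I (hI : M.Indep I) => (mem_levelEq_eRk_iff hI hA).2 ?_
    rwa [(hI.disjoint_loops.mono_right (Matroid.empty_isBasis_iff.1 h)).inter_eq]

theorem mem_faceOf_indepSystem_self (hJ : M.IsBasis J X) : J ∈ faceOf M (indepSystem M) X := by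
  rw [mem_faceOf_indepSystem_iff hJ.subset_ground, inter_eq_self_of_subset_left hJ.subset]
  exact ⟨hJ.indep, hJ⟩

theorem indepFacetDefining_of_isFlat (hA : M.IsFlat A) (hr : IsConnected (M ↾ A))
    (hloops : ¬ A ⊆ M.loops) : IndepFacetDefining M A := by
  have hAE := hA.subset_ground
  refine (isFacet_faceOf_iff hAE).2 ⟨mt (faceOf_indepSystem_eq_self_iff hAE).1 hloops,
    fun Y hY hproper hAY => ?_⟩
  have hbasis : ∀ J, M.IsBasis J A → M.IsBasis (J ∩ Y) Y := fun J hJ =>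
    ((mem_faceOf_indepSystem_iff hY).1 (hAY (mem_faceOf_indepSystem_self hJ))).2
  have hYA : Y ⊆ A := by
    obtain ⟨J, hJ⟩ := M.exists_isBasis A
    calc Y ⊆ M.closure (J ∩ Y) := (hbasis J hJ).subset_closure
      _ ⊆ M.closure J := M.closure_subset_closure inter_subset_left
      _ = A := by rw [hJ.closure_eq_closure, hA.closure]
  have hsep : IsSeparator (M ↾ A) Y := by
    refine isSeparator_iff_forall_isBasis_inter.2 fun B hB => ?_
    exact (Matroid.isBasis_restrict_iff hAE).2
      ⟨hbasis B ((Matroid.isBase_restrict_iff hAE).1 hB), hYA⟩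
  rcases hr.isSeparator_iff.1 hsep with rfl | rfl
  · exact absurd ((faceOf_indepSystem_eq_self_iff hY).2 (empty_subset _)) hproper
  · rfl

theorem IndepFacetDefining.not_subset_loops (h : IndepFacetDefining M A) (hA : A ⊆ M.E) :
    ¬ A ⊆ M.loops :=
  mt (faceOf_indepSystem_eq_self_iff hA).2 ((isFacet_faceOf_iff hA).1 h).1

theorem IndepFacetDefining.faceOf_eq (h : IndepFacetDefining M A) (hA : A ⊆ M.E) (hY : Y ⊆ M.E)
    (hloops : ¬ Y ⊆ M.loops)
    (hbasis : ∀ I, M.Indep I → M.IsBasis (I ∩ A) A → M.IsBasis (I ∩ Y) Y) :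
    faceOf M (indepSystem M) A = faceOf M (indepSystem M) Y := by
  refine ((isFacet_faceOf_iff hA).1 h).2 Y hY (mt (faceOf_indepSystem_eq_self_iff hY).1 hloops)
    fun I hI => ?_
  rw [mem_faceOf_indepSystem_iff hA] at hI
  exact (mem_faceOf_indepSystem_iff hY).2 ⟨hI.1, hbasis I hI.1 hI.2⟩

theorem IndepFacetDefining.isFlat (h : IndepFacetDefining M A) (hA : A ⊆ M.E)
    (hloops : M.loops = ∅) : M.IsFlat A := by
  have hAcl : A ⊆ M.closure A := M.subset_closure A hA
  have hface : faceOf M (indepSystem M) A = faceOf M (indepSystem M) (M.closure A) := by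
    refine h.faceOf_eq hA (M.closure_subset_ground A)
      (fun hcl => h.not_subset_loops hA (hAcl.trans hcl)) fun I hI hIA => ?_
    have hIcl := hIA.isBasis_closure_right
    rwa [← hIcl.eq_of_subset_indep (hI.inter_right _) (inter_subset_inter_right I hAcl)
      inter_subset_right]
  rw [Matroid.isFlat_iff_closure_eq]
  refine Subset.antisymm (fun e he => ?_) hAcl
  have heI : M.Indep {e} := by
    rw [Matroid.indep_singleton, Matroid.isNonloop_iff_mem_compl_loops, hloops, sdiff_empty]
    exact M.closure_subset_ground A he
  obtain ⟨I, hI, heI⟩ := heI.subset_isBasis_of_subset (singleton_subset_iff.2 he)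
  have hIA := ((mem_faceOf_indepSystem_iff hA).1 (hface.ge (mem_faceOf_indepSystem_self hI))).2
  have hII : I ∩ A = I :=
    hIA.isBasis_closure_right.eq_of_subset_indep hI.indep inter_subset_left hI.subset
  exact inter_eq_left.1 hII (heI rfl)

theorem IndepFacetDefining.isConnected_restrict (h : IndepFacetDefining M A) (hA : A ⊆ M.E)
    (hloops : M.loops = ∅) : IsConnected (M ↾ A) := by
  have hne : A.Nonempty := nonempty_iff_ne_empty.2 fun hA0 =>
    h.not_subset_loops hA (hA0 ▸ empty_subset _)
  refine isConnected_iff_isSeparator.2 ⟨hne, fun X hX => or_iff_not_imp_left.2 fun hX0 => ?_⟩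
  have hXA : X ⊆ A := hX.subset_ground
  have hinter : ∀ {I Z}, IsSeparator (M ↾ A) Z → M.IsBasis (I ∩ A) A → M.IsBasis (I ∩ Z) Z := by
    intro I Z hZ hI
    have hZA : Z ⊆ A := hZ.subset_ground
    have := hZ.isBasis_inter ((Matroid.isBase_restrict_iff hA).2 hI)
    rw [Matroid.isBasis_restrict_iff hA, inter_assoc, inter_eq_self_of_subset_right hZA] at this
    exact this.1
  have hface : faceOf M (indepSystem M) A = faceOf M (indepSystem M) X :=
    h.faceOf_eq hA (hXA.trans hA) (by rwa [hloops, subset_empty_iff]) fun I _ => hinter hX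
  obtain ⟨J, hJ⟩ := M.exists_isBasis X (hXA.trans hA)
  have hJA := ((mem_faceOf_indepSystem_iff hA).1 (hface.ge (mem_faceOf_indepSystem_self hJ))).2
  have hJc : M.IsBasis (J ∩ (A \ X)) (A \ X) := hinter hX.compl hJA
  rw [(disjoint_sdiff_right.mono_left hJ.subset).inter_eq, Matroid.empty_isBasis_iff,
    Matroid.closure_empty, hloops, subset_empty_iff, sdiff_eq_empty] at hJc
  exact hXA.antisymm hJc

theorem IsConnected.indepFacetDefining_iff (hM : IsConnected M) (hA : A ⊆ M.E) :
    IndepFacetDefining M A ↔ IsConnected (M ↾ A) ∧ M.IsFlat A ∧ ¬ A ⊆ M.loops := by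
  refine ⟨fun h => ?_, fun ⟨hr, hflat, hloops⟩ => indepFacetDefining_of_isFlat hflat hr hloops⟩
  have hloops := h.not_subset_loops hA
  have hM0 := hM.loops_eq_empty hA hloops
  exact ⟨h.isConnected_restrict hA hM0, h.isFlat hA hM0, hloops⟩

end IndepFacets

section NonTrivial

variable {α : Type*} {M : Matroid α} {A : Set α}

theorem levelEq_inter_levelGT_nonempty_iff (hA : A ⊆ M.E) :
    (levelEq M.E M.E (M.eRk M.E) ∩ levelGT M.E A (M.eRk A)).Nonempty ↔
      M.eRk A < M.eRk M.E ∧ M.eRk A < A.encard := by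
  constructor
  · rintro ⟨I, ⟨hIE, hI⟩, -, hIA⟩
    rw [inter_eq_self_of_subset_left hIE] at hI
    exact ⟨hIA.trans_le (hI ▸ encard_le_encard inter_subset_left),
      hIA.trans_le (encard_le_encard inter_subset_right)⟩
  · rintro ⟨hE, hcard⟩
    obtain ⟨J, hJA, hJ⟩ := exists_subset_encard_eq (Order.add_one_le_of_lt hcard)
    obtain ⟨I, hJI, hIE, hI⟩ := exists_superset_subset_encard_eq (hJA.trans hA)
      (hJ.trans_le (Order.add_one_le_of_lt hE)) (M.eRk_le_encard M.E)
    refine ⟨I, ⟨hIE, by rwa [inter_eq_self_of_subset_left hIE]⟩, hIE, ?_⟩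
    calc M.eRk A < M.eRk A + 1 := ENat.lt_add_one_iff hE.ne_top |>.2 le_rfl
      _ = J.encard := hJ.symm
      _ ≤ (I ∩ A).encard := encard_le_encard (subset_inter hJI hJA)

theorem levelEq_inter_levelLT_nonempty_iff [M.Finite] :
    (levelEq M.E M.E (M.eRk M.E) ∩ levelLT M.E A (M.eRk A)).Nonempty ↔
      0 < M.eRk A ∧ M.eRk M.E < M.eRk A + (M.E \ A).encard := by
  have hfin : (M.E \ A).encard ≠ ⊤ := encard_ne_top_iff.2 M.ground_finite.sdiff
  constructor
  · rintro ⟨I, ⟨hIE, hI⟩, -, hIA⟩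
    rw [inter_eq_self_of_subset_left hIE] at hI
    refine ⟨pos_of_gt hIA, ?_⟩
    calc M.eRk M.E = (I ∩ A).encard + (I \ A).encard := by
          rw [← hI, add_comm, encard_sdiff_add_encard_inter]
      _ ≤ (I ∩ A).encard + (M.E \ A).encard := by
          gcongr
      _ < M.eRk A + (M.E \ A).encard := (ENat.add_lt_add_iff_right hfin).2 hIA
  · rintro ⟨hpos, hlt⟩
    rcases le_total (M.eRk M.E) (M.E \ A).encard with hle | hle
    · obtain ⟨I, hIA, hI⟩ := exists_subset_encard_eq hle
      have hIE : I ⊆ M.E := hIA.trans sdiff_subset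
      refine ⟨I, ⟨hIE, by rwa [inter_eq_self_of_subset_left hIE]⟩, hIE, ?_⟩
      rwa [(disjoint_sdiff_left.mono_left hIA).inter_eq, encard_empty]
    · obtain ⟨I, hAI, hIE, hI⟩ := exists_superset_subset_encard_eq sdiff_subset hle
        (M.eRk_le_encard M.E)
      refine ⟨I, ⟨hIE, by rwa [inter_eq_self_of_subset_left hIE]⟩, hIE,
        (ENat.add_lt_add_iff_right hfin).1 ?_⟩
      calc (I ∩ A).encard + (M.E \ A).encard ≤ (I ∩ A).encard + (I \ A).encard :=
            add_le_add le_rfl (encard_le_encard (subset_sdiff.2 ⟨hAI, disjoint_sdiff_left⟩))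
        _ = M.eRk M.E := by rw [add_comm, encard_sdiff_add_encard_inter, hI]
        _ < M.eRk A + (M.E \ A).encard := hlt

theorem nonTrivialIneq_iff [M.Finite] (hA : A ⊆ M.E) :
    NonTrivialIneq M A ↔ (¬ M.Spanning A ∧ ¬ M.Indep A) ∧
      ¬ A ⊆ M.loops ∧ ¬ M.E \ A ⊆ M.coloops := by
  have hspan : M.eRk A < M.eRk M.E ↔ ¬ M.Spanning A := by
    rw [Matroid.spanning_iff_eRk_le hA, not_le, Matroid.eRk_ground]
  have hindep : M.eRk A < A.encard ↔ ¬ M.Indep A := by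
    rw [Matroid.indep_iff_eRk_eq_encard, (M.eRk_le_encard A).lt_iff_ne]
  have hloops : 0 < M.eRk A ↔ ¬ A ⊆ M.loops := by
    rw [← Matroid.eRk_eq_zero_iff hA, pos_iff_ne_zero]
  have hcoloops : M.eRk M.E < M.eRk A + (M.E \ A).encard ↔ ¬ M.E \ A ⊆ M.coloops := by
    have hdual := M.eRk_dual_add_eRank (M.E \ A)
    rw [sdiff_sdiff_cancel_left hA] at hdual
    rw [← hdual, M.eRk_ground, ← Matroid.dual_loops, ← Matroid.eRk_eq_zero_iff, ← ne_eq,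
      ← pos_iff_ne_zero]
    have hrank : M.eRank ≠ ⊤ := M.eRank_ne_top_iff.2 inferInstance
    simpa only [zero_add] using
      ENat.add_lt_add_iff_right (n := 0) (m := M✶.eRk (M.E \ A)) hrank
  rw [NonTrivialIneq, levelEq_inter_levelGT_nonempty_iff hA, levelEq_inter_levelLT_nonempty_iff,
    hspan, hindep, hloops, hcoloops]

theorem IsConnected.indepFacetDefining_and_dual_iff [M.Finite] (hM : IsConnected M)
    (hA : A ⊆ M.E) :
    IndepFacetDefining M A ∧ IndepFacetDefining M✶ (M.E \ A) ↔
      (IsConnected (M ↾ A) ∧ IsConnected (M ／ A)) ∧ NonTrivialIneq M A := by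
  have hAc : M.E \ A ⊆ M✶.E := sdiff_subset
  have hflat (hc : IsConnected (M ／ A)) : M.IsFlat A ↔ ¬ M.Spanning A :=
    isFlat_iff_not_spanning hA hc
  have hdualflat (hr : IsConnected (M ↾ A)) : M✶.IsFlat (M.E \ A) ↔ ¬ M.Indep A := by
    rw [isFlat_iff_not_spanning hAc ((isConnected_dual_contract_compl hA).2 hr),
      ← Matroid.dual_coindep_iff, Matroid.coindep_iff_compl_spanning, Matroid.dual_ground]
  rw [hM.indepFacetDefining_iff hA, hM.dual.indepFacetDefining_iff hAc,
    isConnected_dual_restrict_compl, Matroid.dual_loops, nonTrivialIneq_iff hA]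
  constructor
  · rintro ⟨⟨hr, hAflat, hloops⟩, hc, hcflat, hcoloops⟩
    exact ⟨⟨hr, hc⟩, ⟨(hflat hc).1 hAflat, (hdualflat hr).1 hcflat⟩, hloops, hcoloops⟩
  · rintro ⟨⟨hr, hc⟩, ⟨hspan, hindep⟩, hloops, hcoloops⟩
    exact ⟨⟨hr, (hflat hc).2 hspan, hloops⟩, hc, (hdualflat hr).2 hindep, hcoloops⟩

end NonTrivial

end MatroidFacet

theorem theorem2p5 {α : Type*} (M : Matroid α) (hfin : M.E.Finite)
    (hM : MatroidFacet.IsConnected M) (A : Set α) (hA : A ⊆ M.E) :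
    List.TFAE
      [MatroidFacet.BaseFacetDefining M A,
       MatroidFacet.IsBaseSystemWithComponents M.E
         (MatroidFacet.faceOf M (MatroidFacet.baseSystem M) A) {A, M.E \ A},
       MatroidFacet.IsConnected (M.restrict A) ∧ MatroidFacet.IsConnected (M.contract A)] ∧
    (MatroidFacet.NonTrivialIneq M A →
      List.TFAE
        [MatroidFacet.BaseFacetDefining M A,
         MatroidFacet.IsBaseSystemWithComponents M.E
           (MatroidFacet.faceOf M (MatroidFacet.baseSystem M) A) {A, M.E \ A},
         MatroidFacet.IsConnected (M.restrict A) ∧ MatroidFacet.IsConnected (M.contract A),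
         MatroidFacet.IndepFacetDefining M A ∧
           MatroidFacet.IndepFacetDefining M.dual (M.E \ A)]) ∧
    (MatroidFacet.IndepFacetDefining M A ∧ MatroidFacet.IndepFacetDefining M.dual (M.E \ A) →
      MatroidFacet.NonTrivialIneq M A) := by
  have : M.Finite := ⟨hfin⟩
  have hac := hM.baseFacetDefining_iff hA
  have hbc := MatroidFacet.isBaseSystemWithComponents_iff hA
  have hd := hM.indepFacetDefining_and_dual_iff hA
  refine ⟨?_, fun hnt => ?_, fun h => (hd.1 h).2⟩
  · tfae_have 1 ↔ 3 := hac
    tfae_have 2 ↔ 3 := hbc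
    tfae_finish
  · tfae_have 1 ↔ 3 := hac
    tfae_have 2 ↔ 3 := hbc
    tfae_have 4 ↔ 3 := hd.trans (and_iff_left hnt)
    tfae_finish
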